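/- Setting. A control-flow graph is a directed multigraph with a finite non-empty set $F$ of nodes (flow-points), $|F|=m$, all reachable from an initial node; each flow-point $f$ has a set $\mathit{Var}(f)$ of exactly $n$ variables. A size-change graph $G:f\to g$ is a bipartite directed graph from $\mathit{Var}(f)$ to $\mathit{Var}(g)$, each arc being labelled strict or non-strict. An SCT instance $\mathcal G$ consists of a control-flow graph and a size-change graph $G_c:f\to g$ for each of its arcs $c$ from $f$ to $g$. It is strongly connected if every flow-point is reachable from every flow-point, and fan-in free if in every $G_c$ each target variable has in-degree at most $1$. It is positive if for every infinite directed path $c_0c_1c_2\dots$ in the control-flow graph, the layered graph obtained by concatenating $G_{c_0},G_{c_1},\dots$ contains an infinite directed path (beginning in any layer) with infinitely many strict arcs. Given a well-ordered set $\mathit{Val}$, a state is a pair $(f,\sigma)$ with $f\in F$ and $\sigma:\mathit{Var}(f)\to\mathit{Val}$. There is a transition from $(f,\sigma)$ to $(g,\sigma')$ if for some arc $c$ from $f$ to $g$, $\sigma(x)>\sigma'(y)$ for every strict arc $x\to y$ of $G_c$ and $\sigma(x)\ge\sigma'(y)$ for every non-strict arc $x\to y$ of $G_c$. A ranking function for $\mathcal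 G$ is a map $\rho$ from the states to a well-founded ordered set such that $\rho_f(\sigma)>\rho_g(\sigma')$ for every transition from $(f,\sigma)$ to $(g,\sigma')$, where $\rho_f(\sigma)=\rho(f,\sigma)$. For $B\in\mathbb N$, let $\widetilde V_f^B$ be the set of tuples $\langle\{x_1\},b_1,\{x_2\},b_2,\dots,\{x_n\},b_n\rangle$ in which $x_1,\dots,x_n$ lists every element of $\mathit{Var}(f)$ exactly once and each $b_i$ is an integer with $0\le b_i\le B$. The value of such a tuple in the store $\sigma$ is $(\sigma(x_1),b_1,\dots,\sigma(x_n),b_n)\in(\mathit{Val}\times\mathbb N)^n$. Values are ordered lexicographically, and for a non-empty finite $S\subseteq\widetilde V_f^B$, $\max_\sigma S$ denotes the largest of the values of its elements in $\sigma$. Statement. Let $\mathcal G$ be a strongly connected, fan-in free, positive SCT instance, and let $B=m\cdot 2^n\cdot n$. Then there are non-empty sets $S_f\subseteq\widetilde V_f^B$ ($f\in F$), depending only on $\mathcal G$, with $|S_f|\le n!$ for every $f$, such that for every well-ordered set $\mathit{Val}$ the function $\rho_f(\sigma)=\max_\sigma S_f$ is a ranking function for $\mathcal G$. -/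

import Mathlib

universe u v w x

namespace SCT

/-- The two labels of a size-change arc: `strict` (`↓`) and `nonstrict` (`↓` or equal). -/
inductive Label where
  | strict
  | nonstrict

/-- A size-change graph with source variables `X` and target variables `Y`: a bipartite directed
graph whose arcs carry a label. `label x y = none` means that there is no arc `x → y`. -/
structure SCGraph (X : Type*) (Y : Type*) where
  label : X → Y → Option Label

namespace SCGraph

variable {X Y : Type*}

/-- There is an arc `x → y`, however labelled. -/
def HasArc (G : SCGraph X Y) (a : X) (b : Y) : Prop := ∃ l, G.label a b = some l

/-- There is a strict arc `x → y`. -/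
def HasStrictArc (G : SCGraph X Y) (a : X) (b : Y) : Prop := G.label a b = some Label.strict

/-- There is a non-strict arc `x → y`. -/
def HasNonstrictArc (G : SCGraph X Y) (a : X) (b : Y) : Prop :=
  G.label a b = some Label.nonstrict

/-- `G ⊨ σ ↦ σ'`: the stores satisfy all the constraints that the arcs of `G` stand for. -/
def Describes {Val : Type*} [LinearOrder Val] (G : SCGraph X Y) (σ : X → Val) (σ' : Y → Val) :
    Prop :=
  (∀ a b, G.HasStrictArc a b → σ' b < σ a) ∧ (∀ a b, G.HasNonstrictArc a b → σ' b ≤ σ a)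

/-- All in-degrees are at most `1`. (Source nodes of a bipartite graph have in-degree `0`.) -/
def FanInFree (G : SCGraph X Y) : Prop := ∀ a a' b, G.HasArc a b → G.HasArc a' b → a = a'

end SCGraph

/-- An SCT instance (annotated control-flow graph) in which every flow-point has `n` variables:
a directed multigraph with finitely many nodes, all of them reachable from an initial node, a set
of variables for every node, and a size-change graph for every arc. -/
structure Instance (n : ℕ) where
  Point : Type u
  [fintypePoint : Fintype Point]
  Arc : Point → Point → Type v
  Var : Point → Type w
  [fintypeVar : ∀ f, Fintype (Var f)]
  card_var : ∀ f, Fintype.card (Var f) = n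
  init : Point
  reachable : ∀ f, Relation.ReflTransGen (fun a b => Nonempty (Arc a b)) init f
  graph : ∀ {f g : Point}, Arc f g → SCGraph (Var f) (Var g)

attribute [instance] Instance.fintypePoint Instance.fintypeVar

/-- An infinite multipath, given by an infinite directed path in the control-flow graph. -/
structure Multipath {n : ℕ} (I : Instance.{u, v, w} n) where
  point : ℕ → I.Point
  arc : ∀ i, I.Arc (point i) (point (i + 1))

/-- An infinite thread of an infinite multipath: an infinite directed path in its layered graph,
which may begin in any layer. -/
structure Multipath.Thread {n : ℕ} {I : Instance.{u, v, w} n} (M : Multipath I) where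
  start : ℕ
  var : ∀ i, I.Var (M.point (start + i))
  hasArc : ∀ i, (I.graph (M.arc (start + i))).HasArc (var i) (var (i + 1))

/-- The thread includes infinitely many strict arcs. -/
def Multipath.Thread.InfinitelyDescending {n : ℕ} {I : Instance.{u, v, w} n} {M : Multipath I}
    (τ : M.Thread) : Prop :=
  ∀ N, ∃ i, N ≤ i ∧ (I.graph (M.arc (τ.start + i))).HasStrictArc (τ.var i) (τ.var (i + 1))

namespace Instance

variable {n : ℕ} (I : Instance.{u, v, w} n)

/-- The number `m` of flow-points. -/
def numPoints : ℕ := Fintype.card I.Point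

/-- The SCT condition: every infinite multipath contains an infinitely descending thread. -/
def Positive : Prop := ∀ M : Multipath I, ∃ τ : M.Thread, τ.InfinitelyDescending

/-- Every size-change graph of the instance is fan-in free. -/
def FanInFree : Prop := ∀ (f g : I.Point) (c : I.Arc f g), (I.graph c).FanInFree

/-- Every flow-point is reachable from every flow-point. -/
def StronglyConnected : Prop :=
  ∀ f g, Relation.ReflTransGen (fun a b => Nonempty (I.Arc a b)) f g

/-- Abstract program states: a flow-point with a store for its variables. -/
abbrev State (Val : Type x) := Σ f : I.Point, (I.Var f → Val)

/-- The transition system of the instance. -/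
def Transition {Val : Type x} [LinearOrder Val] (s s' : I.State Val) : Prop :=
  ∃ c : I.Arc s.1 s'.1, (I.graph c).Describes s.2 s'.2

/-- A (global) ranking function: its codomain is well-founded and it descends on every
transition. -/
def IsRankingFunction {Val : Type x} [LinearOrder Val] {W : Type*} [Preorder W]
    (ρ : I.State Val → W) : Prop :=
  WellFounded (fun a b : W => a < b) ∧ ∀ s s', I.Transition s s' → ρ s' < ρ s

end Instance

/-- The simple vectors over a set `X` of `n` variables, with numbers bounded by `B`: tuples
`⟨{x₁}, b₁, {x₂}, b₂, …⟩` of even length, where the singletons `{xᵢ}` form a partition of `X`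
(so `x₁, x₂, …` lists every variable exactly once, and there are `n` of them) and every `bᵢ` is
an integer between `0` and `B`. -/
structure SimpleVector (X : Type*) (n B : ℕ) where
  var : Fin n ≃ X
  num : Fin n → ℕ
  num_le : ∀ i, num i ≤ B

/-- The value of a simple vector in a store, an element of `(Val × ℕ)ⁿ` under the lexicographic
order. -/
def SimpleVector.value {X : Type*} {n B : ℕ} {Val : Type*} (a : SimpleVector X n B)
    (σ : X → Val) : Lex (Fin n → Lex (Val × ℕ)) :=
  toLex fun i => toLex (σ (a.var i), a.num i)

/-- `max` of the values of the vectors in the non-empty finite set `S`, in the store `σ`. -/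
noncomputable def maxVal {X : Type*} {n B : ℕ} {Val : Type*} [LinearOrder Val]
    (S : Finset (SimpleVector X n B)) (hS : S.Nonempty) (σ : X → Val) :
    Lex (Fin n → Lex (Val × ℕ)) :=
  S.sup' hS fun a => a.value σ

end SCT

/-! Consider the finite graph of pairs `(f, X)`, `X` a set of variables of `f`, with an edge to `(g,
Y)` when some arc of the control-flow graph bounds all of `Y` by `X` through non-strict arcs. The
number of nodes reachable from a node never grows along an edge and drops on leaving a strongly
connected component; these numbers are the `bᵢ`. `S_f` consists of the listings in which no `xᵢ`
dies relative to `{x₁, …, xᵢ₋₁}`: by fan-in freeness the backward trace of a variable along a walk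
is unique, and no backward walk inside the component may end it or lead it into the sets. Such an
`xᵢ` always exists (`exists_not_dies`): otherwise all variables could be killed one after another,
giving a closed walk which, repeated for ever, has no infinitely descending thread. Given a
transition and a listing `y` at its target, a larger listing `x` at its source is built by following
each `yᵢ` back along the transition (`prefix_or_exists_lt`). The first strict arc or change of
component makes `x` larger. If neither occurs, the full variable sets lie on a cycle with only
non-strict arcs, against positivity. -/

namespace SCT

/-! ### Chains as sequences, and lexicographic comparison -/

section Sequences

/-- A nonempty chain of related elements, as a sequence. -/
theorem exists_seq_of_transGen {α : Type*} {r : α → α → Prop} {a b : α}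
    (h : Relation.TransGen r a b) :
    ∃ (k : ℕ) (s : ℕ → α), s 0 = a ∧ s (k + 1) = b ∧ ∀ i ≤ k, r (s i) (s (i + 1)) := by
  induction h with
  | single h =>
    rename_i b
    refine ⟨0, fun i => if i = 0 then a else b, by simp, by simp, ?_⟩
    intro i hi
    obtain rfl : i = 0 := by omega
    simpa using h
  | tail _ h ih =>
    rename_i b c _
    obtain ⟨k, s, h0, h1, hs⟩ := ih
    refine ⟨k + 1, fun i => if i ≤ k + 1 then s i else c, by simp [h0], by simp, ?_⟩
    intro i hi
    rcases Nat.lt_or_ge i (k + 1) with hlt | hge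
    · have h2 : i + 1 ≤ k + 1 := by omega
      simpa [hi, h2] using hs i (by omega)
    · obtain rfl : i = k + 1 := by omega
      simpa [h1] using h

theorem toLex_lt_toLex_of_le_of_lt {n : ℕ} {β : Type*} [LinearOrder β] {a b : Fin n → β}
    (i : Fin n) (hle : ∀ j < i, b j ≤ a j) (hlt : b i < a i) : toLex b < toLex a := by
  refine (not_le (α := Lex (Fin n → β))).1 fun h => ?_
  rcases h.lt_or_eq with h | h
  · obtain ⟨j, hj, hj'⟩ := h
    simp only [Pi.toLex_apply] at hj hj'
    rcases lt_trichotomy i j with hij | rfl | hij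
    · exact absurd (hj i hij) hlt.ne'
    · exact lt_asymm hlt hj'
    · exact not_lt_of_ge (hle j hij) hj'
  · have : a = b := toLex.injective h
    exact hlt.ne (congrFun this i).symm

end Sequences

/-! ### The graph of variable sets and its rank -/

namespace Instance

variable {n : ℕ} (I : Instance.{u, v, w} n)

/-- A flow-point with a set of its variables. -/
abbrev Node := Σ f : I.Point, Set (I.Var f)

/-- Along the arc `c`, every variable of `Y` is bounded by a variable of `X` through a non-strict
arc. -/
def Carries {f g : I.Point} (c : I.Arc f g) (X : Set (I.Var f)) (Y : Set (I.Var g)) : Prop :=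
  ∀ y ∈ Y, ∃ x ∈ X, (I.graph c).HasNonstrictArc x y

def Edge (p q : I.Node) : Prop := ∃ c : I.Arc p.1 q.1, I.Carries c p.2 q.2

abbrev Reach : I.Node → I.Node → Prop := Relation.ReflTransGen I.Edge

/-- The number of nodes reachable from `p`. -/
noncomputable def rank (p : I.Node) : ℕ := Nat.card {q // I.Reach p q}

theorem card_node : Nat.card I.Node = I.numPoints * 2 ^ n := by
  classical
  rw [Nat.card_sigma]
  simp [Instance.numPoints, Nat.card_eq_fintype_card, I.card_var]

instance : Finite I.Node := by
  infer_instance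

theorem rank_le (p : I.Node) : I.rank p ≤ I.numPoints * 2 ^ n := by
  rw [← I.card_node]
  exact Nat.card_le_card_of_injective _ Subtype.val_injective

variable {I}

theorem rank_le_rank {p q : I.Node} (h : I.Reach p q) : I.rank q ≤ I.rank p :=
  Nat.card_le_card_of_injective (fun x => ⟨x.1, h.trans x.2⟩ : {x // I.Reach q x} → _)
    fun _ _ hxy => Subtype.ext (Subtype.mk.inj hxy)

theorem rank_lt_rank {p q : I.Node} (h : I.Reach p q) (h' : ¬ I.Reach q p) :
    I.rank q < I.rank p := by
  have hsub : {x | I.Reach q x} ⊂ {x | I.Reach p x} := by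
    refine ⟨fun x hx => h.trans hx, fun hs => h' (hs (Relation.ReflTransGen.refl))⟩
  exact Set.ncard_lt_ncard hsub (Set.toFinite _)

/-! ### Backward tracing and positivity -/

variable (I)

/-- The variable `y` cannot be traced back for ever, outside the sets of the nodes, inside the
strongly connected component of `p`. -/
inductive Dies : (p : I.Node) → I.Var p.1 → Prop
  | mem {p : I.Node} {y : I.Var p.1} (h : y ∈ p.2) : Dies p y
  | step {p q : I.Node} (c : I.Arc p.1 q.1) (hc : I.Carries c p.2 q.2) (hqp : I.Reach q p)
      (y : I.Var q.1) (h : ∀ x, (I.graph c).HasArc x y → Dies p x) : Dies q y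

/-- A node with a set of variables that are traced backwards. -/
abbrev Trace := Σ p : I.Node, Set (I.Var p.1)

/-- A step within a strongly connected component, along which every source of a traced variable is
traced or belongs to the set of its node. -/
def TraceStep (s t : I.Trace) : Prop :=
  ∃ c : I.Arc s.1.1 t.1.1, I.Carries c s.1.2 t.1.2 ∧
    ∀ x y, (I.graph c).HasArc x y → y ∈ t.2 → x ∉ s.1.2 → x ∈ s.2

variable {I}

/-- In a positive fan-in free instance no closed walk loses all threads outside its sets. -/
theorem not_transGen_traceStep (hfan : I.FanInFree) (hpos : I.Positive) (p : I.Node) :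
    ¬ Relation.TransGen I.TraceStep ⟨p, ∅⟩ ⟨p, p.2ᶜ⟩ := by
  intro h
  obtain ⟨k, s, h0, h1, hs⟩ := exists_seq_of_transGen h
  -- The closed walk is repeated for ever. At multiples of `k + 1` the traced set is reset from
  -- `p.2ᶜ` to `∅`.
  let t : ℕ → I.Trace := fun i => s (i % (k + 1))
  have ht0 : ∀ i, i % (k + 1) = 0 → (t i).2 = ∅ := by
    intro i hi
    change (s (i % (k + 1))).2 = ∅
    rw [hi, h0]
  have ht : ∀ i, ∃ c : I.Arc (t i).1.1 (t (i + 1)).1.1, I.Carries c (t i).1.2 (t (i + 1)).1.2 ∧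
      ((i + 1) % (k + 1) = 0 → ∀ x y, (I.graph c).HasArc x y → x ∉ (t i).1.2 → x ∉ (t i).2 →
        y ∈ (t (i + 1)).1.2) ∧
      ((i + 1) % (k + 1) ≠ 0 → ∀ x y, (I.graph c).HasArc x y → x ∉ (t i).1.2 → x ∉ (t i).2 →
        y ∉ (t (i + 1)).2) := by
    intro i
    have hlt : i % (k + 1) < k + 1 := Nat.mod_lt _ (Nat.succ_pos k)
    have hstep := hs (i % (k + 1)) (by omega)
    by_cases hi : (i + 1) % (k + 1) = 0
    · have hik : i % (k + 1) = k := by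
        by_contra hne
        have : (i + 1) % (k + 1) = i % (k + 1) + 1 := by
          rw [Nat.add_mod, Nat.mod_eq_of_lt (a := 1) (by omega), Nat.mod_eq_of_lt (by omega)]
        omega
      rw [hik, h1] at hstep
      have e1 : t i = s k := congrArg s hik
      have e2 : t (i + 1) = ⟨p, ∅⟩ := (congrArg s hi).trans h0
      rw [e1, e2]
      obtain ⟨c, hc, hx⟩ := hstep
      refine ⟨c, hc, fun _ x y hxy hx1 hx2 => ?_, fun h => absurd hi h⟩
      by_contra hy
      exact hx2 (hx x y hxy hy hx1)
    · have hik : (i + 1) % (k + 1) = i % (k + 1) + 1 := by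
        have hne : i % (k + 1) ≠ k := by
          intro hk
          apply hi
          rw [← Nat.mod_add_mod, hk, Nat.mod_self]
        rw [← Nat.mod_add_mod, Nat.mod_eq_of_lt (by omega)]
      have e2 : t (i + 1) = s (i % (k + 1) + 1) := congrArg s hik
      rw [e2]
      obtain ⟨c, hc, hx⟩ := hstep
      exact ⟨c, hc, fun h => absurd h hi, fun _ x y hxy hx1 hx2 hy => hx2 (hx x y hxy hy hx1)⟩
  choose c hc hreset hkeep using ht
  obtain ⟨τ, hτ⟩ := hpos ⟨fun i => (t i).1.1, c⟩
  -- By fan-in freeness the arc of the thread into a node's set is the non-strict one that carries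
  -- the set. So after its first strict arc the thread stays outside the sets.
  have hback : ∀ i, τ.var (i + 1) ∈ (t (τ.start + (i + 1))).1.2 →
      τ.var i ∈ (t (τ.start + i)).1.2 ∧
        ¬ (I.graph (c (τ.start + i))).HasStrictArc (τ.var i) (τ.var (i + 1)) := by
    intro i hi
    obtain ⟨x, hx, hxy⟩ := hc (τ.start + i) _ hi
    obtain rfl : x = τ.var i := hfan _ _ _ _ _ _ ⟨_, hxy⟩ (τ.hasArc i)
    refine ⟨hx, fun hst => ?_⟩
    have := hst.symm.trans hxy
    simp at this
  have hnot : ∀ i d, τ.var (i + d) ∈ (t (τ.start + (i + d))).1.2 →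
      τ.var i ∈ (t (τ.start + i)).1.2 := by
    intro i d
    induction d with
    | zero => exact id
    | succ d ih => exact fun h => ih (hback _ h).1
  obtain ⟨N, hN⟩ : ∃ N, ∀ i ≥ N, τ.var i ∉ (t (τ.start + i)).1.2 := by
    obtain ⟨j, -, hst⟩ := hτ 0
    refine ⟨j + 1, fun i hi hmem => ?_⟩
    obtain ⟨d, rfl⟩ := Nat.exists_eq_add_of_le hi
    exact (hback j (hnot (j + 1) d hmem)).2 hst
  have hexists : ∀ a, ∃ i ≥ a, (τ.start + i) % (k + 1) = 0 := by
    intro a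
    refine ⟨(a + τ.start) * (k + 1) - τ.start, ?_, ?_⟩
    · have : (a + τ.start) * 1 ≤ (a + τ.start) * (k + 1) := Nat.mul_le_mul_left _ (by omega)
      omega
    · have : (a + τ.start) * 1 ≤ (a + τ.start) * (k + 1) := Nat.mul_le_mul_left _ (by omega)
      rw [Nat.add_sub_cancel' (by omega), Nat.mul_mod_left]
  obtain ⟨a, haN, ha⟩ := hexists N
  -- A thread outside the sets and untraced at a reset stays untraced. At the end of the period,
  -- where all of `p.2ᶜ` is traced, it would have to lie in `p.2`.
  have hlost : ∀ d, τ.var (a + d) ∉ (t (τ.start + (a + d))).2 := by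
    intro d
    induction d with
    | zero =>
      exact fun hmem => Set.notMem_empty _ ((ht0 _ ha).le hmem)
    | succ d ih =>
      by_cases hd : (τ.start + (a + d) + 1) % (k + 1) = 0
      · exact fun hmem => Set.notMem_empty _ ((ht0 _ hd).le hmem)
      · exact hkeep _ hd _ _ (τ.hasArc _) (hN _ (by omega)) ih
  obtain ⟨b, hab, hb⟩ := hexists (a + 1)
  obtain ⟨d, rfl⟩ := Nat.exists_eq_add_of_le hab
  have e : a + 1 + d = a + d + 1 := by omega
  rw [e] at hb
  exact hN (a + d + 1) (by omega)
    (hreset (τ.start + (a + d)) hb _ _ (τ.hasArc _) (hN _ (by omega)) (hlost d))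

/-- The sources of a set of variables, outside the set of the node. -/
theorem traceStep_sources {p q : I.Node} {c : I.Arc p.1 q.1} (hc : I.Carries c p.2 q.2)
    (K : Set (I.Var q.1)) :
    I.TraceStep ⟨p, {x | x ∉ p.2 ∧ ∃ y ∈ K, (I.graph c).HasArc x y}⟩ ⟨q, K⟩ :=
  ⟨c, hc, fun _ y hxy hy hx => ⟨hx, y, hy, hxy⟩⟩

theorem exists_trace_empty_of_reach {p q : I.Node} (h : I.Reach p q) :
    Relation.ReflTransGen I.TraceStep ⟨p, ∅⟩ ⟨q, ∅⟩ := by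
  induction h with
  | refl => exact .refl
  | tail _ h ih =>
    obtain ⟨c, hc⟩ := h
    exact ih.tail ⟨c, hc, fun _ _ _ hy => absurd hy (Set.notMem_empty _)⟩

theorem ncard_sources_le (hfan : I.FanInFree) {f g : I.Point} (c : I.Arc f g)
    (X : Set (I.Var f)) (K : Set (I.Var g)) :
    {x | x ∉ X ∧ ∃ y ∈ K, (I.graph c).HasArc x y}.ncard ≤ K.ncard := by
  have h : ∀ x ∈ {x | x ∉ X ∧ ∃ y ∈ K, (I.graph c).HasArc x y},
      ∃ y ∈ K, (I.graph c).HasArc x y := fun x hx => hx.2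
  rcases K.eq_empty_or_nonempty with rfl | hK
  · simp
  have : Nonempty (I.Var g) := ⟨hK.some⟩
  choose! φ hφ harc using h
  refine Set.ncard_le_ncard_of_injOn φ hφ (fun x hx x' hx' hxx => ?_) (Set.toFinite _)
  have h1 := harc x hx
  rw [hxx] at h1
  exact hfan _ _ _ _ _ _ h1 (harc x' hx')

/-- Following the walk that kills `y` backwards, the traced set never grows, by fan-in freeness, and
it loses an element when the trace of `y` ends. -/
theorem Dies.exists_trace_lt (hfan : I.FanInFree) {q : I.Node} {y : I.Var q.1}
    (h : I.Dies q y) : ∀ K : Set (I.Var q.1), K ⊆ q.2ᶜ → y ∈ K →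
      ∃ (p : I.Node) (L : Set (I.Var p.1)), Relation.ReflTransGen I.TraceStep ⟨p, L⟩ ⟨q, K⟩ ∧
        I.Reach p q ∧ I.Reach q p ∧ L ⊆ p.2ᶜ ∧ L.ncard < K.ncard := by
  induction h with
  | mem h => exact fun K hK hy => absurd h (hK hy)
  | @step p q c hc hqp y h ih =>
    intro K hK hy
    let L : Set (I.Var p.1) := {x | x ∉ p.2 ∧ ∃ y ∈ K, (I.graph c).HasArc x y}
    have hstep : I.TraceStep ⟨p, L⟩ ⟨q, K⟩ := traceStep_sources hc K
    have hpq : I.Reach p q := .single ⟨c, hc⟩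
    by_cases hx : ∃ x ∈ L, (I.graph c).HasArc x y
    · obtain ⟨x, hxL, hxy⟩ := hx
      obtain ⟨p', L', h1, h2, h3, h4, h5⟩ := ih x hxy L (fun _ hx => hx.1) hxL
      exact ⟨p', L', h1.tail hstep, h2.trans hpq, hqp.trans h3, h4,
        h5.trans_le (ncard_sources_le hfan c _ _)⟩
    -- No traced source leads to `y`, so `K \ {y}` already accounts for all of `L`.
    · refine ⟨p, L, .single hstep, hpq, hqp, fun _ hx => hx.1, ?_⟩
      have hL : L ⊆ {x | x ∉ p.2 ∧ ∃ y' ∈ K \ {y}, (I.graph c).HasArc x y'} := by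
        rintro x ⟨hxp, y', hy', hxy'⟩
        refine ⟨hxp, y', ⟨hy', ?_⟩, hxy'⟩
        rintro rfl
        exact hx ⟨x, ⟨hxp, y', hy', hxy'⟩, hxy'⟩
      exact ((Set.ncard_le_ncard hL (Set.toFinite _)).trans (ncard_sources_le hfan c _ _)).trans_lt
        (Set.ncard_sdiff_singleton_lt_of_mem hy (Set.toFinite _))

theorem dies_of_reach {p q : I.Node} (hpq : I.Reach p q) (hqp : I.Reach q p)
    (h : ∀ x, I.Dies p x) : ∀ y, I.Dies q y := by
  induction hpq with
  | refl => exact h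
  | @tail r s hpr hrs ih =>
    obtain ⟨c, hc⟩ := hrs
    exact fun y => .step c hc (hqp.trans hpr) y
      fun x _ => ih ((Relation.ReflTransGen.single ⟨c, hc⟩).trans hqp) x

theorem exists_trace_empty (hfan : I.FanInFree) {q : I.Node} (h : ∀ y, I.Dies q y)
    (K : Set (I.Var q.1)) (hK : K ⊆ q.2ᶜ) :
    ∃ p : I.Node, Relation.ReflTransGen I.TraceStep ⟨p, ∅⟩ ⟨q, K⟩ ∧ I.Reach q p := by
  induction hn : K.ncard using Nat.strong_induction_on generalizing q K with
  | _ k ih =>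
    rcases K.eq_empty_or_nonempty with rfl | ⟨y, hy⟩
    · exact ⟨q, .refl, .refl⟩
    · obtain ⟨p, L, h1, h2, h3, h4, h5⟩ := (h y).exists_trace_lt hfan K hK hy
      obtain ⟨p', h6, h7⟩ := ih _ (hn ▸ h5) (dies_of_reach h3 h2 h) L h4 rfl
      exact ⟨p', h6.trans h1, h3.trans h7⟩

theorem exists_not_dies (hfan : I.FanInFree) (hpos : I.Positive) (p : I.Node)
    (hp : p.2 ≠ Set.univ) : ∃ x, ¬ I.Dies p x := by
  by_contra! h
  obtain ⟨q, h1, h2⟩ := exists_trace_empty hfan h p.2ᶜ subset_rfl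
  refine not_transGen_traceStep hfan hpos p ?_
  rcases Relation.reflTransGen_iff_eq_or_transGen.1 ((exists_trace_empty_of_reach h2).trans h1)
    with h3 | h3
  -- The empty walk would force `p.2ᶜ = ∅`.
  · rw [Sigma.mk.injEq, heq_eq_eq] at h3
    exact absurd (Set.compl_empty_iff.1 h3.2) hp
  · exact h3

/-- Inside a strongly connected component no arc has only non-strict threads. -/
theorem not_reach_univ (hfan : I.FanInFree) (hpos : I.Positive) {f g : I.Point}
    (h : I.Edge ⟨f, Set.univ⟩ ⟨g, Set.univ⟩) : ¬ I.Reach ⟨g, Set.univ⟩ ⟨f, Set.univ⟩ := by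
  intro hr
  refine not_transGen_traceStep hfan hpos ⟨g, Set.univ⟩ ?_
  obtain ⟨c, hc⟩ := h
  rw [Set.compl_univ]
  exact Relation.TransGen.tail' (exists_trace_empty_of_reach hr)
    ⟨c, hc, fun _ _ _ hy => absurd hy (Set.notMem_empty _)⟩

/-! ### Listings that survive backward tracing -/

/-- The first `k` variables of a list can be traced back for ever, each one outside the set of the
preceding ones. -/
def Preserved {f : I.Point} (x : Fin n → I.Var f) (k : ℕ) : Prop :=
  ∀ i : Fin n, i.val < k → ¬ I.Dies ⟨f, x '' Set.Iio i⟩ (x i)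

theorem Preserved.injective {f : I.Point} {x : Fin n → I.Var f} (h : Preserved x n) :
    Function.Injective x := by
  have key : ∀ i j : Fin n, i < j → x i ≠ x j := fun i j hij e =>
    h j j.2 (.mem (e ▸ Set.mem_image_of_mem x hij : x j ∈ x '' Set.Iio j))
  intro i j e
  rcases lt_trichotomy i j with hij | hij | hij
  · exact absurd e (key i j hij)
  · exact hij
  · exact absurd e.symm (key j i hij)

theorem Preserved.bijective {f : I.Point} {x : Fin n → I.Var f} (h : Preserved x n) :
    Function.Bijective x :=
  (Fintype.bijective_iff_injective_and_card x).2 ⟨h.injective, by simp [I.card_var]⟩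

theorem image_update_Iio {β : Type*} (x : Fin n → β) {i k : Fin n} (hik : i ≤ k) (z : β) :
    Function.update x k z '' Set.Iio i = x '' Set.Iio i :=
  Set.image_congr fun _ hj => Function.update_of_ne (lt_of_lt_of_le hj hik).ne _ _

theorem Preserved.update {f : I.Point} {x : Fin n → I.Var f} {k : Fin n} (h : Preserved x k)
    {z : I.Var f} (hz : ¬ I.Dies ⟨f, x '' Set.Iio k⟩ z) :
    Preserved (Function.update x k z) (k + 1) := by
  intro i hi
  have hik : i ≤ k := Fin.le_def.2 (by omega)
  rw [image_update_Iio x hik]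
  rcases hik.lt_or_eq with hlt | rfl
  · rw [Function.update_of_ne hlt.ne]
    exact h i hlt
  · rwa [Function.update_self]

theorem Preserved.exists_extension (hfan : I.FanInFree) (hpos : I.Positive) {f : I.Point}
    {k : ℕ} (hk : k ≤ n) {x : Fin n → I.Var f} (h : Preserved x k) :
    ∃ x' : Fin n → I.Var f, Preserved x' n ∧ ∀ i : Fin n, i.val < k → x' i = x i := by
  induction hd : n - k generalizing k x with
  | zero =>
    obtain rfl : k = n := by omega
    exact ⟨x, h, fun _ _ => rfl⟩
  | succ d ih =>
    have hkn : k < n := by omega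
    let i : Fin n := ⟨k, hkn⟩
    -- Fewer than `n` variables are used so far, so `exists_not_dies` supplies the next one.
    have hne : x '' Set.Iio i ≠ Set.univ := by
      classical
      intro hu
      have h1 : (x '' Set.Iio i).ncard ≤ (Set.Iio i).ncard := Set.ncard_image_le (Set.toFinite _)
      rw [hu, Set.ncard_univ, Nat.card_eq_fintype_card, I.card_var, Set.ncard_eq_toFinset_card',
        Set.toFinset_Iio, Fin.card_Iio] at h1
      exact absurd h1 (not_le.2 hkn)
    obtain ⟨z, hz⟩ := exists_not_dies hfan hpos ⟨f, x '' Set.Iio i⟩ hne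
    obtain ⟨x', hx', hxx⟩ := ih (k := k + 1) hkn (Preserved.update (k := i) h hz) (by omega)
    refine ⟨x', hx', fun j hj => ?_⟩
    rw [hxx j (by omega), Function.update_of_ne (Fin.ne_of_val_ne (by simp [i]; omega))]

/-! ### Descent along a transition -/

/-- The number attached to the `i`-th entry of a vector. -/
noncomputable def rankAt {f : I.Point} (x : Fin n → I.Var f) (i : Fin n) : ℕ :=
  I.rank ⟨f, x '' Set.Iic i⟩

theorem rankAt_congr {f : I.Point} {x x' : Fin n → I.Var f} {i : Fin n}
    (h : ∀ j ≤ i, x' j = x j) : rankAt x' i = rankAt x i := by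
  unfold rankAt
  rw [show x' '' Set.Iic i = x '' Set.Iic i from Set.image_congr h]

/-- The value of a list of variables in a store. -/
noncomputable def listValue {Val : Type*} {f : I.Point} (x : Fin n → I.Var f) (σ : I.Var f → Val) :
    Lex (Fin n → Lex (Val × ℕ)) :=
  toLex fun i => toLex (σ (x i), rankAt x i)

/-- The final `Reach` keeps both prefixes in one component; this is what lets `Dies.step` apply to
the arc `c` at the next position. -/
theorem prefix_or_exists_lt (hconn : I.StronglyConnected) (hfan : I.FanInFree)
    (hpos : I.Positive) {Val : Type x} [LinearOrder Val] {f g : I.Point} (c : I.Arc f g)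
    {σ : I.Var f → Val} {σ' : I.Var g → Val} (hσ : (I.graph c).Describes σ σ')
    {y : Fin n → I.Var g} (hy : Preserved y n) (k : ℕ) (hk : k ≤ n) :
    (∃ x : Fin n → I.Var f, Preserved x n ∧ listValue y σ' < listValue x σ) ∨
    ∃ x : Fin n → I.Var f, Preserved x k ∧
      (∀ i : Fin n, i.val < k → (I.graph c).HasNonstrictArc (x i) (y i) ∧
        rankAt y i ≤ rankAt x i) ∧
      I.Reach ⟨g, y '' {i | i.val < k}⟩ ⟨f, x '' {i | i.val < k}⟩ := by
  induction k with
  | zero =>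
    right
    obtain ⟨e⟩ : Nonempty (Fin n ≃ I.Var f) :=
      ⟨(Fintype.equivFinOfCardEq (I.card_var f)).symm⟩
    refine ⟨e, fun i hi => absurd hi (Nat.not_lt_zero _), fun i hi => absurd hi (Nat.not_lt_zero _),
      ?_⟩
    simp only [Nat.not_lt_zero, Set.ofPred_false, Set.image_empty]
    -- Empty sets are carried by every arc, so strong connectivity starts the induction.
    refine (hconn g f).lift (fun f : I.Point => (⟨f, ∅⟩ : I.Node)) ?_
    rintro a b ⟨c⟩
    exact ⟨c, fun _ hy => absurd hy (Set.notMem_empty _)⟩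
  | succ k ih =>
    rcases ih (by omega) with h | ⟨x, hx, harc, hreach⟩
    · exact Or.inl h
    let i : Fin n := ⟨k, hk⟩
    have hIio : {j : Fin n | j.val < k} = Set.Iio i := rfl
    have hIic : {j : Fin n | j.val < k + 1} = Set.Iic i := Set.ext fun j => Nat.lt_succ_iff
    rw [hIio] at hreach
    have hcar : I.Carries c (x '' Set.Iio i) (y '' Set.Iio i) := by
      rintro _ ⟨j, hj, rfl⟩
      exact ⟨x j, ⟨j, hj, rfl⟩, (harc j hj).1⟩
    obtain ⟨z, hzy, hz⟩ : ∃ z, (I.graph c).HasArc z (y i) ∧ ¬ I.Dies ⟨f, x '' Set.Iio i⟩ z := by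
      by_contra! hall
      exact hy i i.2 (.step (p := ⟨f, x '' Set.Iio i⟩) (q := ⟨g, y '' Set.Iio i⟩) c hcar hreach
        (y i) hall)
    let x₁ := Function.update x i z
    have hx₁ : Preserved x₁ (k + 1) := Preserved.update (k := i) hx hz
    have hx₁i : x₁ i = z := Function.update_self ..
    have hx₁j : ∀ j < i, x₁ j = x j := fun j hj => Function.update_of_ne hj.ne _ _
    have hrank : ∀ j < i, rankAt x₁ j = rankAt x j := fun j hj =>
      rankAt_congr fun l hl => hx₁j l (hl.trans_lt hj)
    have hle : ∀ j < i, (toLex (σ' (y j), rankAt y j) : Lex (Val × ℕ)) ≤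
        toLex (σ (x₁ j), rankAt x₁ j) := by
      intro j hj
      obtain ⟨h1, h2⟩ := harc j hj
      rw [hrank j hj, hx₁j j hj]
      exact Prod.Lex.toLex_mono ⟨hσ.2 _ _ h1, h2⟩
    -- A strict gain at position `i` decides the comparison: completing the listing leaves the
    -- entries and ranks up to `i` unchanged.
    have hwin : (toLex (σ' (y i), rankAt y i) : Lex (Val × ℕ)) < toLex (σ z, rankAt x₁ i) →
        ∃ x : Fin n → I.Var f, Preserved x n ∧ listValue y σ' < listValue x σ := by
      intro hlt
      obtain ⟨x', hx', hxx⟩ := hx₁.exists_extension hfan hpos hk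
      have hxx' : ∀ j ≤ i, x' j = x₁ j := fun j hj => hxx j (Nat.lt_succ_of_le hj)
      have hr : ∀ j ≤ i, rankAt x' j = rankAt x₁ j := fun j hj =>
        rankAt_congr fun l hl => hxx' l (hl.trans hj)
      refine ⟨x', hx', toLex_lt_toLex_of_le_of_lt i (fun j hj => ?_) ?_⟩
      · rw [hxx' j hj.le, hr j hj.le]
        exact hle j hj
      · rw [hxx' i le_rfl, hr i le_rfl, hx₁i]
        exact hlt
    obtain ⟨l, hl⟩ := id hzy
    cases l with
    | strict => exact Or.inl (hwin (Prod.Lex.toLex_lt_toLex.2 (Or.inl (hσ.1 _ _ hl))))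
    | nonstrict =>
      have harc₁ : ∀ j ≤ i, (I.graph c).HasNonstrictArc (x₁ j) (y j) := by
        intro j hj
        rcases hj.lt_or_eq with hj | rfl
        · rw [hx₁j j hj]
          exact (harc j hj).1
        · rw [hx₁i]
          exact hl
      have hedge : I.Reach ⟨f, x₁ '' Set.Iic i⟩ ⟨g, y '' Set.Iic i⟩ := by
        refine .single ⟨c, ?_⟩
        rintro _ ⟨j, hj, rfl⟩
        exact ⟨x₁ j, ⟨j, hj, rfl⟩, harc₁ j hj⟩
      by_cases hback : I.Reach ⟨g, y '' Set.Iic i⟩ ⟨f, x₁ '' Set.Iic i⟩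
      · refine Or.inr ⟨x₁, hx₁, fun j hj => ?_, by rwa [hIic]⟩
        have hj' : j ≤ i := Nat.lt_succ_iff.1 hj
        refine ⟨harc₁ j hj', ?_⟩
        rcases hj'.lt_or_eq with hj | rfl
        · rw [hrank j hj]
          exact (harc j hj).2
        · exact rank_le_rank hedge
      · refine Or.inl (hwin ?_)
        rcases (hσ.2 _ _ hl).lt_or_eq with h | h
        · exact Prod.Lex.toLex_lt_toLex.2 (Or.inl h)
        · exact Prod.Lex.toLex_lt_toLex.2 (Or.inr ⟨h, rank_lt_rank hedge hback⟩)

theorem exists_listValue_lt (hconn : I.StronglyConnected) (hfan : I.FanInFree)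
    (hpos : I.Positive) {Val : Type x} [LinearOrder Val] {f g : I.Point} (c : I.Arc f g)
    {σ : I.Var f → Val} {σ' : I.Var g → Val} (hσ : (I.graph c).Describes σ σ')
    {y : Fin n → I.Var g} (hy : Preserved y n) :
    ∃ x : Fin n → I.Var f, Preserved x n ∧ listValue y σ' < listValue x σ := by
  rcases prefix_or_exists_lt hconn hfan hpos c hσ hy n le_rfl with h | ⟨x, hx, harc, hreach⟩
  · exact h
  · exfalso
    have huniv : {i : Fin n | i.val < n} = Set.univ := Set.eq_univ_of_forall fun i => i.2
    rw [huniv, Set.image_univ, Set.image_univ, hx.bijective.2.range_eq,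
      hy.bijective.2.range_eq] at hreach
    refine not_reach_univ hfan hpos ⟨c, fun z _ => ?_⟩ hreach
    obtain ⟨i, rfl⟩ := hy.bijective.2 z
    exact ⟨x i, trivial, (harc i i.2).1⟩

/-! ### The sets `S_f` and the ranking function -/

theorem rankAt_le {f : I.Point} (x : Fin n → I.Var f) (i : Fin n) :
    rankAt x i ≤ I.numPoints * 2 ^ n * n :=
  (I.rank_le _).trans (Nat.le_mul_of_pos_right _ (Fin.pos i))

/-- The simple vector of a listing of the variables. -/
noncomputable def toVector {f : I.Point} (e : Fin n ≃ I.Var f) :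
    SimpleVector (I.Var f) n (I.numPoints * 2 ^ n * n) :=
  ⟨e, rankAt e, rankAt_le e⟩

open Classical in
/-- The simple vectors of the listings of the variables of `f` in which each variable can be traced
back for ever. -/
noncomputable def vectors (I : Instance.{u, v, w} n) (f : I.Point) :
    Finset (SimpleVector (I.Var f) n (I.numPoints * 2 ^ n * n)) :=
  (Finset.univ.filter fun e : Fin n ≃ I.Var f => Preserved e n).image toVector

theorem mem_vectors {f : I.Point} {a : SimpleVector (I.Var f) n (I.numPoints * 2 ^ n * n)} :
    a ∈ I.vectors f ↔ ∃ e : Fin n ≃ I.Var f, Preserved e n ∧ toVector e = a := by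
  simp [vectors]

theorem toVector_ofBijective_mem {f : I.Point} {x : Fin n → I.Var f} (hx : Preserved x n) :
    toVector (Equiv.ofBijective x hx.bijective) ∈ I.vectors f :=
  mem_vectors.2 ⟨_, hx, rfl⟩

theorem vectors_nonempty (hfan : I.FanInFree) (hpos : I.Positive) (f : I.Point) :
    (I.vectors f).Nonempty := by
  obtain ⟨x, hx, -⟩ := Preserved.exists_extension hfan hpos (Nat.zero_le n)
    (x := (Fintype.equivFinOfCardEq (I.card_var f)).symm) fun i hi => absurd hi (Nat.not_lt_zero _)
  exact ⟨_, toVector_ofBijective_mem hx⟩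

theorem card_vectors_le (f : I.Point) : (I.vectors f).card ≤ n.factorial := by
  classical
  refine Finset.card_image_le.trans ((Finset.card_filter_le _ _).trans ?_)
  rw [Finset.card_univ, Fintype.card_equiv (Fintype.equivFinOfCardEq (I.card_var f)).symm,
    Fintype.card_fin]

end Instance

end SCT

theorem corollary5p4 (n : ℕ) (I : SCT.Instance.{u, v, w} n) (hconn : I.StronglyConnected)
    (hfan : I.FanInFree) (hpos : I.Positive) :
    ∃ (S : ∀ f : I.Point, Finset (SCT.SimpleVector (I.Var f) n (I.numPoints * 2 ^ n * n)))
      (hS : ∀ f, (S f).Nonempty),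
      (∀ f, (S f).card ≤ n.factorial) ∧
      ∀ (Val : Type x) [LinearOrder Val] [WellFoundedLT Val],
        I.IsRankingFunction
          (fun s : I.State Val => SCT.maxVal (S s.1) (hS s.1) s.2) := by
  refine ⟨I.vectors, SCT.Instance.vectors_nonempty hfan hpos, SCT.Instance.card_vectors_le, ?_⟩
  intro Val _ _
  refine ⟨wellFounded_lt, ?_⟩
  rintro ⟨f, σ⟩ ⟨g, σ'⟩ ⟨c, hc⟩
  refine (Finset.sup'_lt_iff _).2 fun b hb => ?_
  obtain ⟨e, he, rfl⟩ := SCT.Instance.mem_vectors.1 hb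
  obtain ⟨y, hy, hlt⟩ := SCT.Instance.exists_listValue_lt hconn hfan hpos c hc he
  exact lt_of_lt_of_le hlt
    (Finset.le_sup' (fun a => a.value σ) (SCT.Instance.toVector_ofBijective_mem hy))
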